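/- \textbf{Theorem (moderate deviation principle for quenched means).} Let $\xi=(\xi_n)_{n\ge 0}$ be a stationary and ergodic sequence with values in a measurable space $\Theta$, and let $\theta\mapsto\eta(\theta)$ be a measurable map (a probability kernel) from $\Theta$ to the probability distributions on $\mathbb N\times\mathbb R\times\mathbb R\times\cdots$, where $\mathbb N=\{0,1,2,\dots\}$. Given $\xi$, consider the branching random walk with environment $\xi$ in time: under the quenched law $\mathbb P_\xi$ (with expectation $\mathbb E_\xi$) the random vectors $X(u)=(N(u),L_1(u),L_2(u),\dots)$, indexed by the finite sequences $u$ of positive integers, are independent, and $X(u)$ has distribution $\eta(\xi_n)$ if $u$ has length $|u|=n$; the initial particle $\emptyset$ is at $S_\emptyset=0$, and a particle $u$ of generation $n$ located at $S_u$ is replaced by $N(u)$ particles $ui$, $1\le i\le N(u)$, of generation $n+1$, located at $S_{ui}=S_u+L_i(u)$. Let $\mathbb T_n$ be the set of particles of generation $n$ and $Z_n=\sum_{u\in\mathbb T_n}\delta_{S_u}$ the counting measure of their positions. Write $N=N(\emptyset)$, $L_i=L_i(\emptyset)$, $\mathbb E$ for the expectation with respect to the total law (the law of $\xi$ followed by $\mathbb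 P_\xi$), and $\pi_0=m_0(0)=\mathbb E_\xi N$. Assume that $0<\pi_0<\infty$ a.s., and that $$\operatorname*{ess\,sup}\ \frac1{\pi_0}\,\mathbb E_\xi\sum_{i=1}^N e^{\delta|L_i|}<\infty\ \text{ for some }\delta>0,\qquad \mathbb E_\xi\sum_{i=1}^N L_i=0\quad\text{a.s.}$$ Let $(a_n)$ be a sequence of positive numbers with $a_n/n\to0$ and $a_n/\sqrt n\to\infty$. Put $$\sigma^2=\mathbb E\Big[\frac1{\pi_0}\sum_{i=1}^N L_i^2\Big],\qquad I(x)=\frac{x^2}{2\sigma^2},$$ where, if $\sigma^2=0$, $I(0)=0$ and $I(x)=\infty$ for $x\ne0$. Then $\sigma^2<\infty$ and, for almost every $\xi$, the maps $$q_n(A)=\frac{\mathbb E_\xi Z_n(a_nA)}{\mathbb E_\xi Z_n(\mathbb R)}$$ are probability measures on $\mathbb R$ for all $n$ and satisfy, for every Borel set $A\subseteq\mathbb R$ with interior $A^o$ and closure $\bar A$, $$-\inf_{x\in A^o}I(x)\ \le\ \liminf_{n\to\infty}\frac{n}{a_n^2}\log q_n(A)\ \le\ \limsup_{n\to\infty}\frac{n}{a_n^2}\log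 q_n(A)\ \le\ -\inf_{x\in\bar A}I(x),$$ with $\log0=-\infty$ and $\inf\emptyset=+\infty$. -/

import Mathlib

open MeasureTheory ProbabilityTheory Filter Topology
open scoped ENNReal Pointwise

namespace BRWRE

/-- A mark `(N, L_1, L_2, …)`: the number of children of a particle and the displacements of its
children.  Children are numbered from `0`, so the relevant displacements are `L i` with `i < N`. -/
abbrev Mark : Type := ℕ × (ℕ → ℝ)

/-- Particles are labelled by finite sequences of naturals, the last letter first: `i :: u` is the
child number `i` of the particle `u`, `[]` is the initial particle, and the generation of `u` is
`u.length`. -/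
abbrev Label : Type := List ℕ

/-- A realisation of the family of marks `X(u)`, one for each label `u`. -/
abbrev Marks : Type := Label → Mark

/-- The time shift on environment sequences. -/
def shift {Θ : Type*} (ξ : ℕ → Θ) : ℕ → Θ := fun n => ξ (n + 1)

/-- The position `S_u` : `S_∅ = 0` and `S_{ui} = S_u + L_i(u)`. -/
def position (ω : Marks) : Label → ℝ
  | [] => 0
  | i :: u => position ω u + (ω u).2 i

/-- `u` belongs to the Galton–Watson tree: `∅` does, and `ui` does iff `u` does and `ui` is one of
the `N(u)` children of `u`. -/
def InTree (ω : Marks) : Label → Prop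
  | [] => True
  | i :: u => InTree ω u ∧ i < (ω u).1

/-- The particles of generation `n`. -/
def generation (n : ℕ) (ω : Marks) : Set Label := {u | InTree ω u ∧ u.length = n}

/-- The counting measure `Z_n = ∑_{u ∈ T_n} δ_{S_u}` of the particles of generation `n`. -/
noncomputable def Z (n : ℕ) (ω : Marks) : Measure ℝ :=
  Measure.sum fun u : generation n ω => Measure.dirac (position ω u)

section Quenched

variable {Θ : Type*} [MeasurableSpace Θ]

/-- The quenched law `P_ξ`: the marks `X(u)` are independent and `X(u)` has law `η(ξ_{|u|})`. -/
noncomputable def quenchedLaw (η : Kernel Θ Mark) [IsMarkovKernel η] (ξ : ℕ → Θ) :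
    Measure Marks :=
  Measure.infinitePi fun u : Label => η (ξ u.length)

/-- `E_ξ ∑_{i=1}^{N(u)} f(L_i(u))` for the particle `u = 11⋯1` of generation `n`, for nonnegative
`f`. -/
noncomputable def quenchedSum (η : Kernel Θ Mark) [IsMarkovKernel η] (ξ : ℕ → Θ) (n : ℕ)
    (f : ℝ → ℝ≥0∞) : ℝ≥0∞ :=
  ∫⁻ ω, ∑ i ∈ Finset.range (ω (List.replicate n 0)).1, f ((ω (List.replicate n 0)).2 i)
    ∂(quenchedLaw η ξ)

/-- `m_n(t) = E_ξ ∑_{i=1}^{N(u)} exp(t L_i(u))`, `|u| = n`. -/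
noncomputable def m (η : Kernel Θ Mark) [IsMarkovKernel η] (ξ : ℕ → Θ) (n : ℕ) (t : ℝ) : ℝ≥0∞ :=
  quenchedSum η ξ n fun x => ENNReal.ofReal (Real.exp (t * x))

/-- `σ² = E[π₀⁻¹ ∑_{i=1}^N L_i²]` with `π₀ = m_0(0)`; the annealed expectation is the integral over
the law `τ` of the environment of the quenched expectation. -/
noncomputable def sigmaSq (η : Kernel Θ Mark) [IsMarkovKernel η] (τ : Measure (ℕ → Θ)) : ℝ≥0∞ :=
  ∫⁻ ξ, (m η ξ 0 0)⁻¹ * quenchedSum η ξ 0 (fun x => ENNReal.ofReal (x ^ 2)) ∂τ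

/-- The quenched mean measure `E_ξ Z_n`. -/
noncomputable def meanZ (η : Kernel Θ Mark) [IsMarkovKernel η] (ξ : ℕ → Θ) (n : ℕ) : Measure ℝ :=
  (quenchedLaw η ξ).bind (Z n)

/-- The measure `A ↦ E_ξ Z_n(c A) / E_ξ Z_n(ℝ)`, for `c > 0`. -/
noncomputable def normalizedMean (η : Kernel Θ Mark) [IsMarkovKernel η] (ξ : ℕ → Θ) (n : ℕ)
    (c : ℝ) : Measure ℝ :=
  (meanZ η ξ n Set.univ)⁻¹ • (meanZ η ξ n).map (fun x => x / c)

end Quenched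

/-- The rate function `x ↦ x² / (2 s)`; if `s = 0`, it is `0` at `0` and `∞` elsewhere. -/
noncomputable def rate (s : ℝ≥0∞) (x : ℝ) : ℝ≥0∞ := ENNReal.ofReal (x ^ 2) / (2 * s)

theorem measurable_position (u : Label) : Measurable fun ω : Marks => position ω u := by
  induction u with
  | nil => exact measurable_const
  | cons i u ih =>
    have h : Measurable fun ω : Marks => (ω u).2 i :=
      (measurable_pi_apply i).comp (measurable_snd.comp (measurable_pi_apply u))
    exact ih.add h

theorem measurableSet_inTree (u : Label) : MeasurableSet {ω : Marks | InTree ω u} := by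
  induction u with
  | nil => simp [InTree]
  | cons i u ih =>
    have h : Measurable fun ω : Marks => (ω u).1 := measurable_fst.comp (measurable_pi_apply u)
    exact ih.inter (h measurableSet_Ioi)

theorem Z_apply (n : ℕ) (ω : Marks) {A : Set ℝ} (hA : MeasurableSet A) :
    Z n ω A = ∑' u : Label, Set.indicator {ω : Marks | InTree ω u ∧ u.length = n}
      (fun ω => A.indicator (fun _ => (1 : ℝ≥0∞)) (position ω u)) ω := by
  rw [Z, Measure.sum_apply _ hA,
    tsum_subtype (generation n ω) (fun u => (Measure.dirac (position ω u)) A)]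
  refine tsum_congr fun u => ?_
  by_cases h : InTree ω u ∧ u.length = n
  · rw [Set.indicator_of_mem (by exact h), Set.indicator_of_mem (by exact h),
      Measure.dirac_apply' _ hA]
    rfl
  · rw [Set.indicator_of_notMem (by exact h), Set.indicator_of_notMem (by exact h)]

theorem measurable_Z (n : ℕ) : Measurable (Z n) := by
  refine Measure.measurable_of_measurable_coe _ fun A hA => ?_
  simp only [Z_apply n _ hA]
  refine Measurable.tsum fun u => ?_
  refine Measurable.indicator ?_ ((measurableSet_inTree u).inter (MeasurableSet.const _))
  exact (measurable_const.indicator hA).comp (measurable_position u)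

theorem meanZ_apply {Θ : Type*} [MeasurableSpace Θ] (η : Kernel Θ Mark) [IsMarkovKernel η]
    (ξ : ℕ → Θ) (n : ℕ) {A : Set ℝ} (hA : MeasurableSet A) :
    meanZ η ξ n A = ∫⁻ ω, Z n ω A ∂(quenchedLaw η ξ) :=
  Measure.bind_apply hA (measurable_Z n).aemeasurable

theorem normalizedMean_apply {Θ : Type*} [MeasurableSpace Θ] (η : Kernel Θ Mark)
    [IsMarkovKernel η] (ξ : ℕ → Θ) (n : ℕ) {c : ℝ} (hc : 0 < c) {A : Set ℝ}
    (hA : MeasurableSet A) :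
    normalizedMean η ξ n c A =
      (∫⁻ ω, Z n ω (c • A) ∂(quenchedLaw η ξ)) / ∫⁻ ω, Z n ω Set.univ ∂(quenchedLaw η ξ) := by
  have hpre : (fun x : ℝ => x / c) ⁻¹' A = c • A := by
    ext x
    rw [Set.mem_smul_set_iff_inv_smul_mem₀ hc.ne', Set.mem_preimage, smul_eq_mul, div_eq_inv_mul]
  have hm : Measurable fun x : ℝ => x / c := measurable_id.div_const c
  have hcA : MeasurableSet (c • A) := hpre ▸ hm hA
  rw [← meanZ_apply η ξ n hcA, ← meanZ_apply η ξ n MeasurableSet.univ, normalizedMean,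
    Measure.smul_apply, Measure.map_apply hm hA, hpre, smul_eq_mul, ENNReal.div_eq_inv_mul]

end BRWRE

/-! Given the environment, a label's weight depends on the marks of its strict ancestors only, hence
is independent of its own mark. Grouping particles by parent therefore turns the Laplace transform
of `meanZ η ξ n` into the product of the one-step transforms `markLaplace η t (ξ k)`
(`lintegral_exp_meanZ`). After normalisation this is the transform of a sum of independent centred
variables whose laws follow the environment.

Write `v k` for the normalised second moment of step `k`. The uniform exponential moment gives
`markLaplace η t (ξ k) / markLaplace η 0 (ξ k) = exp (t² v k / 2 + O(|t|³))` with constants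
independent of `k` (`exists_markLaplace_bounds`). Take `t = l a_n / n` and speed `b_n = a_n² / n`:
the quadratic terms add up to `b_n l² / 2` times the average of the `v k`, which tends to `σ²` by
Birkhoff's theorem (`ae_tendsto_birkhoffSum_div`), while the cubic errors are `b_n · O(a_n / n)`. So
the scaled log-Laplace transforms converge to `l² σ² / 2` (`hasGaussianLaplace_normalizedMean`).

A Gärtner–Ellis argument for this quadratic limit finishes the proof: Chernoff bounds on two
half-lines for the upper bound, exponential tilting for the lower bound
(`HasGaussianLaplace.limsup_le`, `HasGaussianLaplace.le_liminf`). Both are arranged to cover `σ² =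
0`. -/

namespace BRWRE

/-! ### Birkhoff's ergodic theorem, from a maximal-sum argument. -/

section Birkhoff

variable {α : Type*}

/-- The maximum of the Birkhoff sums `S_0 = 0, S_1, …, S_n`, by the recursion
`M_{n+1} = max 0 (f + M_n ∘ T)`. -/
def maxSum (T : α → α) (f : α → ℝ) : ℕ → α → ℝ
  | 0 => 0
  | n + 1 => fun x => max 0 (f x + maxSum T f n (T x))

variable {T : α → α} {f : α → ℝ}

theorem maxSum_nonneg (n : ℕ) (x : α) : 0 ≤ maxSum T f n x := by
  cases n with
  | zero => exact le_rfl
  | succ n => exact le_max_left _ _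

theorem maxSum_mono (x : α) : Monotone fun n => maxSum T f n x := by
  refine monotone_nat_of_le_succ fun n => ?_
  induction n generalizing x with
  | zero => exact maxSum_nonneg 1 x
  | succ n ih =>
    exact max_le_max le_rfl (add_le_add le_rfl (ih (T x)))

theorem birkhoffSum_le_maxSum (n : ℕ) (x : α) : birkhoffSum T f n x ≤ maxSum T f n x := by
  induction n generalizing x with
  | zero => simp [maxSum]
  | succ n ih =>
    rw [birkhoffSum_succ']
    exact (add_le_add le_rfl (ih (T x))).trans (le_max_right _ _)

/-- Once `maxSum T f n (T x)` exceeds `-f x` the difference is exactly `f x`; this is how `∫ f` is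
recovered from integrals of maxima. -/
theorem maxSum_succ_sub (n : ℕ) (x : α) :
    maxSum T f (n + 1) x - maxSum T f n (T x) = max (-maxSum T f n (T x)) (f x) := by
  rw [maxSum, max_sub_sub_right _ _ _ |>.symm]
  simp

/-- Makes boundedness a strictly `T`-invariant event, so that ergodicity gives it probability zero
or one. -/
theorem bddAbove_maxSum_comp (x : α) :
    BddAbove (Set.range fun n => maxSum T f n (T x)) ↔
      BddAbove (Set.range fun n => maxSum T f n x) := by
  constructor
  · rintro ⟨B, hB⟩
    refine ⟨max 0 (f x + B), ?_⟩
    rintro _ ⟨n, rfl⟩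
    cases n with
    | zero => exact le_max_left _ _
    | succ n => exact max_le_max le_rfl (add_le_add le_rfl (hB ⟨n, rfl⟩))
  · rintro ⟨B, hB⟩
    refine ⟨B - f x, ?_⟩
    rintro _ ⟨n, rfl⟩
    have h1 : f x + maxSum T f n (T x) ≤ maxSum T f (n + 1) x := le_max_right _ _
    have h2 : maxSum T f (n + 1) x ≤ B := hB ⟨n + 1, rfl⟩
    simp only
    linarith

variable [MeasurableSpace α]

theorem measurable_maxSum (hT : Measurable T) (hf : Measurable f) (n : ℕ) :
    Measurable (maxSum T f n) := by
  induction n with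
  | zero => exact measurable_const
  | succ n ih => exact measurable_const.max (hf.add (ih.comp hT))

theorem integrable_maxSum {μ : Measure α} (hT : MeasurePreserving T μ μ) (hf : Integrable f μ)
    (n : ℕ) : Integrable (maxSum T f n) μ := by
  induction n with
  | zero => exact integrable_zero _ _ _
  | succ n ih =>
    exact (integrable_zero _ _ _).sup (hf.add (hT.integrable_comp_of_integrable ih))

/-- If `∫ f < 0`, the Birkhoff sums of `f` are almost surely bounded above. -/
theorem ae_bddAbove_maxSum {μ : Measure α} [IsProbabilityMeasure μ] (hT : Ergodic T μ)
    (hfm : Measurable f) (hf : Integrable f μ) (hneg : ∫ x, f x ∂μ < 0) :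
    ∀ᵐ x ∂μ, BddAbove (Set.range fun n => maxSum T f n x) := by
  have hmeas : MeasurableSet {x | BddAbove (Set.range fun n => maxSum T f n x)} :=
    measurableSet_bddAbove_range fun n => measurable_maxSum hT.measurable hfm n
  refine (hT.toPreErgodic.ae_mem_or_ae_notMem hmeas ?_).resolve_right fun hunb => ?_
  · ext x
    exact bddAbove_maxSum_comp x
  have hint : ∀ n, Integrable (fun x => max (-maxSum T f n (T x)) (f x)) μ := fun n =>
    ((hT.toMeasurePreserving.integrable_comp_of_integrable
      (integrable_maxSum hT.toMeasurePreserving hf n)).neg).sup hf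
  -- By invariance of `μ` this is `∫ (M_{n+1} - M_n)`, and the maxima increase with `n`.
  have hpos : ∀ n, 0 ≤ ∫ x, max (-maxSum T f n (T x)) (f x) ∂μ := by
    intro n
    have h1 := integrable_maxSum hT.toMeasurePreserving hf n
    have h2 := integrable_maxSum hT.toMeasurePreserving hf (n + 1)
    have h3 : Integrable (fun x => maxSum T f n (T x)) μ :=
      hT.toMeasurePreserving.integrable_comp_of_integrable h1
    have h4 : ∫ x, maxSum T f n (T x) ∂μ = ∫ x, maxSum T f n x ∂μ := by
      rw [← integral_map hT.measurable.aemeasurable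
        (by rw [hT.map_eq]; exact h1.aestronglyMeasurable), hT.map_eq]
    simp only [← maxSum_succ_sub]
    rw [integral_sub h2 h3, h4]
    exact sub_nonneg.2 (integral_mono h1 h2 fun x => maxSum_mono x n.le_succ)
  -- If the maxima are a.e. unbounded, the truncation at `-M_n ∘ T` eventually disappears; the limit
  -- of nonnegative integrals would be `∫ f < 0`.
  have hlim : Tendsto (fun n => ∫ x, max (-maxSum T f n (T x)) (f x) ∂μ) atTop
      (𝓝 (∫ x, f x ∂μ)) := by
    refine tendsto_integral_of_dominated_convergence (fun x => |f x|)
      (fun n => (hint n).aestronglyMeasurable) hf.abs (fun n => ae_of_all _ fun x => ?_) ?_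
    · rw [Real.norm_eq_abs, abs_le]
      exact ⟨(neg_abs_le _).trans (le_max_right _ _),
        max_le ((neg_nonpos.2 (maxSum_nonneg n _)).trans (abs_nonneg _)) (le_abs_self _)⟩
    · filter_upwards [hunb] with x hx
      have hx' : ¬ BddAbove (Set.range fun n => maxSum T f n (T x)) := fun h =>
        hx ((bddAbove_maxSum_comp x).1 h)
      have htop := tendsto_atTop_atTop_of_monotone' (maxSum_mono (T x)) hx'
      refine tendsto_const_nhds.congr' ?_
      filter_upwards [htop.eventually_ge_atTop (-f x)] with n hn
      rw [max_eq_right]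
      linarith
  exact absurd (ge_of_tendsto' hlim hpos) (not_le.2 hneg)

theorem ae_eventually_birkhoffSum_le {μ : Measure α} [IsProbabilityMeasure μ] (hT : Ergodic T μ)
    (hfm : Measurable f) (hf : Integrable f μ) {ε : ℝ} (hε : 0 < ε) :
    ∀ᵐ x ∂μ, ∀ᶠ n : ℕ in atTop, birkhoffSum T f n x ≤ n * (∫ x, f x ∂μ + ε) := by
  -- Half of `ε` makes `f - c` have negative mean; the other half absorbs the random bound `B` once
  -- `n ≥ B / (ε / 2)`.
  set c := ∫ x, f x ∂μ + ε / 2 with hc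
  have hneg : ∫ x, (f x - c) ∂μ < 0 := by
    rw [integral_sub hf (integrable_const _)]
    simp [hc, hε]
  filter_upwards [ae_bddAbove_maxSum hT (hfm.sub_const c) (hf.sub (integrable_const _)) hneg]
    with x hx
  obtain ⟨B, hB⟩ := hx
  filter_upwards [eventually_ge_atTop ⌈B / (ε / 2)⌉₊] with n hn
  have h1 : birkhoffSum T (fun x => f x - c) n x ≤ B :=
    (birkhoffSum_le_maxSum n x).trans (hB ⟨n, rfl⟩)
  have h2 : birkhoffSum T (fun x => f x - c) n x = birkhoffSum T f n x - n * c := by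
    simp [birkhoffSum, Finset.sum_sub_distrib]
  have h3 : B / (ε / 2) ≤ n := (Nat.le_ceil _).trans (by exact_mod_cast hn)
  rw [div_le_iff₀ (by positivity)] at h3
  rw [h2, hc] at h1
  linarith

/-- Birkhoff's pointwise ergodic theorem for an ergodic map. -/
theorem ae_tendsto_birkhoffSum_div {μ : Measure α} [IsProbabilityMeasure μ] (hT : Ergodic T μ)
    (hfm : Measurable f) (hf : Integrable f μ) :
    ∀ᵐ x ∂μ, Tendsto (fun n : ℕ => birkhoffSum T f n x / n) atTop (𝓝 (∫ x, f x ∂μ)) := by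
  have h1 : ∀ᵐ x ∂μ, ∀ j : ℕ, ∀ᶠ n : ℕ in atTop,
      birkhoffSum T f n x ≤ n * (∫ x, f x ∂μ + 1 / ((j : ℝ) + 1)) :=
    ae_all_iff.2 fun j => ae_eventually_birkhoffSum_le hT hfm hf (by positivity)
  have h2 : ∀ᵐ x ∂μ, ∀ j : ℕ, ∀ᶠ n : ℕ in atTop,
      birkhoffSum T (fun x => -f x) n x ≤ n * (∫ x, -f x ∂μ + 1 / ((j : ℝ) + 1)) :=
    ae_all_iff.2 fun j => ae_eventually_birkhoffSum_le hT hfm.neg hf.neg (by positivity)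
  filter_upwards [h1, h2] with x h1 h2
  rw [Metric.tendsto_nhds]
  intro ε hε
  obtain ⟨j, hj⟩ := exists_nat_one_div_lt hε
  filter_upwards [h1 j, h2 j, eventually_gt_atTop 0] with n hn1 hn2 hn
  have hn' : (0 : ℝ) < n := by exact_mod_cast hn
  have h3 : birkhoffSum T (fun x => -f x) n x = -birkhoffSum T f n x := by
    simp [birkhoffSum]
  rw [h3, integral_neg] at hn2
  have h4 : birkhoffSum T f n x / n ≤ ∫ x, f x ∂μ + 1 / ((j : ℝ) + 1) := by
    rw [div_le_iff₀ hn']; linarith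
  have h5 : ∫ x, f x ∂μ - 1 / ((j : ℝ) + 1) ≤ birkhoffSum T f n x / n := by
    rw [le_div_iff₀ hn']; linarith
  rw [Real.dist_eq, abs_lt]
  constructor <;> linarith

end Birkhoff

/-! ### Independence along ancestral lines and the Laplace transform of the mean measure. -/

/-- `∑_{i=1}^N f(L_i)` for a mark `(N, L_1, L_2, …)`. -/
def markSum {M : Type*} [AddCommMonoid M] (f : ℝ → M) (x : Mark) : M :=
  ∑ i ∈ Finset.range x.1, f (x.2 i)

theorem measurable_markSum {M : Type*} [AddCommMonoid M] [MeasurableSpace M] [MeasurableAdd₂ M]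
    {f : ℝ → M} (hf : Measurable f) : Measurable (markSum f) := by
  refine measurable_from_prod_countable_right fun n => ?_
  exact Finset.measurable_fun_sum (Finset.range n) fun i _ => hf.comp (measurable_pi_apply i)

theorem position_congr {ω ω' : Marks} (u : Label) (h : ∀ v, v <:+ u → v ≠ u → ω v = ω' v) :
    position ω u = position ω' u := by
  induction u with
  | nil => rfl
  | cons i u ih =>
    have hu : ∀ v, v <:+ u → ω v = ω' v := fun v hv =>
      h v (hv.trans (List.suffix_cons i u)) fun e => by simpa [e] using hv.length_le
    rw [position, position, ih fun v hv _ => hu v hv, hu u List.suffix_rfl]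

theorem inTree_congr {ω ω' : Marks} (u : Label) (h : ∀ v, v <:+ u → v ≠ u → ω v = ω' v) :
    InTree ω u ↔ InTree ω' u := by
  induction u with
  | nil => rfl
  | cons i u ih =>
    have hu : ∀ v, v <:+ u → ω v = ω' v := fun v hv =>
      h v (hv.trans (List.suffix_cons i u)) fun e => by simpa [e] using hv.length_le
    rw [InTree, InTree, ih fun v hv _ => hu v hv, hu u List.suffix_rfl]

/-- A function of the marks of the strict ancestors of `u` is independent of the mark of `u`. -/
theorem lintegral_mul_of_ancestors {μ : Label → Measure Mark} [∀ u, IsProbabilityMeasure (μ u)]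
    (u : Label) {F : Marks → ℝ≥0∞} (hF : Measurable F)
    (hFu : ∀ ω ω' : Marks, (∀ v, v <:+ u → v ≠ u → ω v = ω' v) → F ω = F ω')
    {H : Mark → ℝ≥0∞} (hH : Measurable H) :
    ∫⁻ ω, F ω * H (ω u) ∂(Measure.infinitePi μ) =
      (∫⁻ ω, F ω ∂(Measure.infinitePi μ)) * ∫⁻ x, H x ∂(μ u) := by
  classical
  set S : Finset Label := u.tails.toFinset.erase u with hS
  have hind : iIndepFun (fun (v : Label) (ω : Marks) => ω v) (Measure.infinitePi μ) :=
    iIndepFun_infinitePi (X := fun _ x => x) fun _ => measurable_id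
  have hdisj : Disjoint S {u} := by simp [hS]
  have h1 := hind.indepFun_finset S {u} hdisj fun v => measurable_pi_apply v
  -- Marks outside the finite set `S` of strict ancestors get a dummy value, which `F` does not see;
  -- hence `F` factors through the coordinates in `S`.
  set ext : (S → Mark) → Marks := fun r v => if hv : v ∈ S then r ⟨v, hv⟩ else (0, 0) with hext
  have hextm : Measurable ext := by
    refine measurable_pi_lambda _ fun v => ?_
    by_cases hv : v ∈ S
    · simpa [hext, hv] using measurable_pi_apply _
    · simp [hext, hv]
  have hFe : ∀ ω : Marks, F ω = F (ext fun v : S => ω v) := by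
    intro ω
    refine hFu _ _ fun v hv hvu => ?_
    have : v ∈ S := by simp [hS, hv, hvu]
    simp [hext, this]
  have h2 : IndepFun F (fun ω => H (ω u)) (Measure.infinitePi μ) := by
    have h3 := h1.comp (φ := fun r => F (ext r))
      (ψ := fun r : (({u} : Finset Label) → Mark) => H (r ⟨u, by simp⟩)) (hF.comp hextm)
      (hH.comp (measurable_pi_apply _))
    rwa [show F = (fun r => F (ext r)) ∘ fun (ω : Marks) (v : S) => ω v from funext hFe]
  refine (lintegral_mul_eq_lintegral_mul_lintegral_of_indepFun'' hF.aemeasurable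
    (hH.comp (measurable_pi_apply u)).aemeasurable h2).trans ?_
  congr 1
  exact (measurePreserving_eval_infinitePi μ u).lintegral_comp hH

theorem lintegral_Z (n : ℕ) (ω : Marks) {f : ℝ → ℝ≥0∞} (hf : Measurable f) :
    ∫⁻ x, f x ∂(Z n ω) = ∑' u : Label, Set.indicator {ω : Marks | InTree ω u ∧ u.length = n}
      (fun ω => f (position ω u)) ω := by
  rw [Z, lintegral_sum_measure]
  simp only [lintegral_dirac' _ hf]
  rw [tsum_subtype (generation n ω) (fun u => f (position ω u))]
  rfl

/-- The weight of the label `u` in the Laplace transform of the counting measure. -/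
noncomputable def weight (t : ℝ) (u : Label) : Marks → ℝ≥0∞ :=
  Set.indicator {ω : Marks | InTree ω u} fun ω => ENNReal.ofReal (Real.exp (t * position ω u))

theorem measurable_weight (t : ℝ) (u : Label) : Measurable (weight t u) := by
  refine Measurable.indicator ?_ (measurableSet_inTree u)
  have := measurable_position u
  fun_prop

theorem weight_cons (t : ℝ) (i : ℕ) (u : Label) (ω : Marks) :
    weight t (i :: u) ω = weight t u ω *
      if i < (ω u).1 then ENNReal.ofReal (Real.exp (t * (ω u).2 i)) else 0 := by
  by_cases h1 : InTree ω u <;> by_cases h2 : i < (ω u).1 <;>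
    simp [weight, InTree, position, h1, h2, mul_add, Real.exp_add,
      ENNReal.ofReal_mul (Real.exp_nonneg _)]

theorem lintegral_exp_Z (t : ℝ) (n : ℕ) (ω : Marks) :
    ∫⁻ x, ENNReal.ofReal (Real.exp (t * x)) ∂(Z n ω) =
      ∑' u : Label, if u.length = n then weight t u ω else 0 := by
  rw [lintegral_Z n ω (by fun_prop)]
  refine tsum_congr fun u => ?_
  by_cases h1 : InTree ω u <;> by_cases h2 : u.length = n <;> simp [weight, h1, h2]

theorem lintegral_exp_Z_succ (t : ℝ) (n : ℕ) (ω : Marks) :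
    ∫⁻ x, ENNReal.ofReal (Real.exp (t * x)) ∂(Z (n + 1) ω) =
      ∑' u : Label, if u.length = n then
        weight t u ω * markSum (fun x => ENNReal.ofReal (Real.exp (t * x))) (ω u) else 0 := by
  -- Generation `n + 1` is summed over pairs (parent, child number); the only label missed is `[]`,
  -- whose length is not `n + 1`.
  have hinj : Function.Injective fun p : Label × ℕ => p.2 :: p.1 := by
    rintro ⟨u, i⟩ ⟨v, j⟩ h
    simp only [List.cons.injEq] at h
    rw [h.1, h.2]
  rw [lintegral_exp_Z, ← hinj.tsum_eq,
    ENNReal.tsum_prod (f := fun u i => if (i :: u).length = n + 1 then weight t (i :: u) ω else 0)]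
  · refine tsum_congr fun u => ?_
    by_cases h : u.length = n
    · simp only [List.length_cons, h, if_true, weight_cons]
      rw [ENNReal.tsum_mul_left, markSum, tsum_eq_sum (s := Finset.range (ω u).1)]
      · congr 1
        exact Finset.sum_congr rfl fun i hi => if_pos (Finset.mem_range.1 hi)
      · intro i hi
        exact if_neg fun h' => hi (Finset.mem_range.2 h')
    · simp [h]
  · intro u hu
    cases u with
    | nil => simp at hu
    | cons i u => exact ⟨(u, i), rfl⟩

section Quenched

variable {Θ : Type*} [MeasurableSpace Θ]

/-- The Laplace transform of the mean displacement measure of a mark of law `η θ`. -/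
noncomputable def markLaplace (η : Kernel Θ Mark) (t : ℝ) (θ : Θ) : ℝ≥0∞ :=
  ∫⁻ x, markSum (fun y => ENNReal.ofReal (Real.exp (t * y))) x ∂(η θ)

variable (η : Kernel Θ Mark) [IsMarkovKernel η] (ξ : ℕ → Θ)

theorem quenchedSum_eq (n : ℕ) {f : ℝ → ℝ≥0∞} (hf : Measurable f) :
    quenchedSum η ξ n f = ∫⁻ x, markSum f x ∂(η (ξ n)) := by
  have h := (measurePreserving_eval_infinitePi (fun u : Label => η (ξ u.length))
    (List.replicate n 0)).lintegral_comp (measurable_markSum hf)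
  rw [List.length_replicate] at h
  exact h

theorem m_eq (n : ℕ) (t : ℝ) : m η ξ n t = markLaplace η t (ξ n) :=
  quenchedSum_eq η ξ n (by fun_prop)

theorem lintegral_meanZ (n : ℕ) {f : ℝ → ℝ≥0∞} (hf : Measurable f) :
    ∫⁻ x, f x ∂(meanZ η ξ n) = ∫⁻ ω, ∫⁻ x, f x ∂(Z n ω) ∂(quenchedLaw η ξ) :=
  Measure.lintegral_bind (measurable_Z n).aemeasurable hf.aemeasurable

/-- The Laplace transform of the quenched mean measure is the product of those of the steps. -/
theorem lintegral_exp_meanZ (t : ℝ) (n : ℕ) :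
    ∫⁻ x, ENNReal.ofReal (Real.exp (t * x)) ∂(meanZ η ξ n) =
      ∏ k ∈ Finset.range n, markLaplace η t (ξ k) := by
  have hme : Measurable fun x : ℝ => ENNReal.ofReal (Real.exp (t * x)) := by fun_prop
  have hprob : IsProbabilityMeasure (quenchedLaw η ξ) := by
    unfold quenchedLaw; infer_instance
  have hmi : ∀ n u, Measurable fun ω : Marks => if u.length = n then weight t u ω else 0 := by
    intro n u
    by_cases h : u.length = n
    · simpa [h] using measurable_weight t u
    · simp [h]
  rw [lintegral_meanZ η ξ n hme]
  induction n with
  | zero =>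
    simp only [lintegral_exp_Z, List.length_eq_zero_iff, tsum_ite_eq, Finset.range_zero,
      Finset.prod_empty]
    simp [weight, InTree, position]
  | succ n ih =>
    rw [Finset.prod_range_succ, ← ih]
    simp only [lintegral_exp_Z_succ]
    simp only [lintegral_exp_Z]
    rw [lintegral_tsum, lintegral_tsum fun u => (hmi n u).aemeasurable, ← ENNReal.tsum_mul_right]
    · refine tsum_congr fun u => ?_
      by_cases h : u.length = n
      · simp only [h, if_true]
        -- The law of the mark of `u` depends on its generation only, so every label contributes the
        -- same factor `markLaplace η t (ξ n)`.
        rw [quenchedLaw, lintegral_mul_of_ancestors u (measurable_weight t u) ?_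
          (measurable_markSum hme), h]
        · rfl
        · intro ω ω' hω
          by_cases hu : InTree ω u
          · simp [weight, hu, (inTree_congr u hω).1 hu, position_congr u hω]
          · simp [weight, hu, mt (inTree_congr u hω).2 hu]
      · simp [h]
    · intro u
      by_cases h : u.length = n
      · simp only [h, if_true]
        exact ((measurable_weight t u).mul
          ((measurable_markSum hme).comp (measurable_pi_apply u))).aemeasurable
      · simp [h]

end Quenched

/-! ### Chernoff and tilting estimates for a quadratic limiting log-Laplace transform. -/

section GartnerEllis

/-- Chernoff's bound for an exponentially tilted measure. -/
theorem setLIntegral_exp_le (p : Measure ℝ) (b l h y : ℝ) (hb : 0 ≤ b) :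
    ∫⁻ x in {x | h * y ≤ h * x}, ENNReal.ofReal (Real.exp (b * l * x)) ∂p ≤
      ENNReal.ofReal (Real.exp (-(b * (h * y)))) *
        ∫⁻ x, ENNReal.ofReal (Real.exp (b * (l + h) * x)) ∂p := by
  rw [← lintegral_const_mul _ (by fun_prop)]
  refine (setLIntegral_mono' (measurableSet_le (by fun_prop) (by fun_prop))
    fun x hx => ?_).trans (setLIntegral_le_lintegral _ _)
  replace hx : h * y ≤ h * x := hx
  rw [← ENNReal.ofReal_mul (Real.exp_nonneg _), ← Real.exp_add]
  refine ENNReal.ofReal_le_ofReal (Real.exp_le_exp.2 ?_)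
  nlinarith [mul_le_mul_of_nonneg_left hx hb]

/-- The scaled logarithmic Laplace transforms of `p n` at speed `b n` converge to
`l ↦ l ^ 2 * s / 2`. -/
def HasGaussianLaplace (p : ℕ → Measure ℝ) (b : ℕ → ℝ) (s : ℝ) : Prop :=
  ∀ l ε : ℝ, 0 < ε → ∀ᶠ n in atTop,
    ENNReal.ofReal (Real.exp (b n * (l ^ 2 * s / 2 - ε))) ≤
      ∫⁻ x, ENNReal.ofReal (Real.exp (b n * l * x)) ∂(p n) ∧
    ∫⁻ x, ENNReal.ofReal (Real.exp (b n * l * x)) ∂(p n) ≤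
      ENNReal.ofReal (Real.exp (b n * (l ^ 2 * s / 2 + ε)))

variable {p : ℕ → Measure ℝ} {b : ℕ → ℝ} {s : ℝ}

/-- The sign of `h` selects the half-line: `x ≥ y` for `h > 0`, `x ≤ y` for `h < 0`. The tilt `l` is
carried along so that the same bound controls the tails of the tilted measures. -/
theorem HasGaussianLaplace.eventually_setLIntegral_le (H : HasGaussianLaplace p b s)
    (hb : Tendsto b atTop atTop) (l h y c : ℝ) (hc : (l + h) ^ 2 * s / 2 - h * y < c) :
    ∀ᶠ n in atTop,
      ∫⁻ x in {x | h * y ≤ h * x}, ENNReal.ofReal (Real.exp (b n * l * x)) ∂(p n) ≤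
        ENNReal.ofReal (Real.exp (b n * c)) := by
  filter_upwards [H (l + h) (c - ((l + h) ^ 2 * s / 2 - h * y)) (sub_pos.2 hc),
    hb.eventually_ge_atTop 0] with n hn hbn
  refine (setLIntegral_exp_le (p n) (b n) l h y hbn).trans ?_
  refine (mul_le_mul_right hn.2 _).trans ?_
  rw [← ENNReal.ofReal_mul (Real.exp_nonneg _), ← Real.exp_add]
  refine ENNReal.ofReal_le_ofReal (Real.exp_le_exp.2 (le_of_eq ?_))
  ring

/-- Constant prefactors are negligible on the exponential scale. -/
theorem eventually_mul_exp_le (hb : Tendsto b atTop atTop) {c c' K : ℝ} (h : c < c') (hK : 0 < K) :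
    ∀ᶠ n in atTop, ENNReal.ofReal K * ENNReal.ofReal (Real.exp (b n * c)) ≤
      ENNReal.ofReal (Real.exp (b n * c')) := by
  filter_upwards [hb.eventually_ge_atTop (Real.log K / (c' - c))] with n hn
  rw [div_le_iff₀ (sub_pos.2 h)] at hn
  rw [← ENNReal.ofReal_mul hK.le]
  refine ENNReal.ofReal_le_ofReal ?_
  nth_rewrite 1 [← Real.exp_log hK]
  rw [← Real.exp_add]
  exact Real.exp_le_exp.2 (by linarith)

theorem HasGaussianLaplace.eventually_measure_le (H : HasGaussianLaplace p b s)
    (hb : Tendsto b atTop atTop) {r h c : ℝ} (hh : 0 < h) (hc : c < h * r - h ^ 2 * s / 2)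
    {A : Set ℝ} (hA : ∀ x ∈ A, r ≤ |x|) :
    ∀ᶠ n in atTop, p n A ≤ ENNReal.ofReal (Real.exp (-(b n * c))) := by
  obtain ⟨c', hc', hc''⟩ := exists_between hc
  filter_upwards [H.eventually_setLIntegral_le hb 0 h r (-c') (by linarith),
    H.eventually_setLIntegral_le hb 0 (-h) (-r) (-c') (by linarith),
    eventually_mul_exp_le hb (neg_lt_neg hc') two_pos] with n h1 h2 h3
  simp only [mul_zero, zero_mul, Real.exp_zero, ENNReal.ofReal_one, lintegral_one,
    Measure.restrict_apply_univ] at h1 h2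
  have hsub : A ⊆ {x | h * r ≤ h * x} ∪ {x | -h * -r ≤ -h * x} := by
    intro x hx
    rcases le_abs.1 (hA x hx) with hx | hx
    · exact Or.inl (mul_le_mul_of_nonneg_left hx hh.le)
    · refine Or.inr ?_
      simp only [Set.mem_ofPred_eq]
      nlinarith
  calc p n A ≤ _ := (measure_mono hsub).trans (measure_union_le _ _)
    _ ≤ _ := add_le_add h1 h2
    _ = ENNReal.ofReal 2 * ENNReal.ofReal (Real.exp (b n * -c')) := by simp [two_mul]
    _ ≤ _ := h3.trans_eq (by rw [mul_neg])

/-- The lower bound for balls around `l * s`, the mean of the limiting tilted law. -/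
theorem HasGaussianLaplace.eventually_le_measure (H : HasGaussianLaplace p b s) (hs : 0 ≤ s)
    (hb : Tendsto b atTop atTop) {l ε c : ℝ} (hε : 0 < ε) (hc : l ^ 2 * s / 2 < c)
    {A : Set ℝ} (hA : Metric.ball (l * s) ε ⊆ A) :
    ∀ᶠ n in atTop, ENNReal.ofReal (Real.exp (-(b n * c))) ≤ p n A := by
  -- shrink the ball so that the oscillation of the tilt is small
  obtain ⟨c', hc', hcc⟩ := exists_between hc
  set κ := min ε ((c - c') / (|l| + 1)) with hκ
  have hκ0 : 0 < κ := lt_min hε (div_pos (sub_pos.2 hcc) (by positivity))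
  have hκl : |l| * κ ≤ c - c' := by
    have : κ ≤ (c - c') / (|l| + 1) := min_le_right _ _
    rw [le_div_iff₀ (by positivity)] at this
    nlinarith
  set B := Metric.ball (l * s) κ with hB
  have hBA : B ⊆ A := (Metric.ball_subset_ball (min_le_left _ _)).trans hA
  -- The denominator `s + 1` gives `h * s < κ` even when `s = 0`.
  set h := κ / (s + 1) with hh
  have hh0 : 0 < h := by positivity
  have hhs : h * s < κ := by
    rw [hh, div_mul_eq_mul_div, div_lt_iff₀ (by positivity)]
    nlinarith
  -- Chernoff's exponent at distance `κ` from `l * s` is `(l ± h)² s / 2 ∓ h (l s ± κ) = l² s / 2 -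
  -- γ`, so under the tilt both tails lose to the total mass at rate `γ`.
  set γ := h * (κ - h * s / 2) with hγ
  have hγ0 : 0 < γ := mul_pos hh0 (by nlinarith [mul_nonneg hh0.le hs])
  -- The first bound makes each tail at most a quarter of `E`; the second keeps `l² s - c'` strictly
  -- below `l² s / 2 - d`, so that a factor `2` can be absorbed.
  set d := min (γ / 4) ((c' - l ^ 2 * s / 2) / 2) with hd
  have hd0 : 0 < d := lt_min (by positivity) (by linarith)
  have hd1 : d ≤ γ / 4 := min_le_left _ _
  have hd2 : d ≤ (c' - l ^ 2 * s / 2) / 2 := min_le_right _ _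
  filter_upwards [H l d hd0,
    H.eventually_setLIntegral_le hb l h (l * s + κ) (l ^ 2 * s / 2 - γ / 2)
      (by rw [hγ] at *; nlinarith),
    H.eventually_setLIntegral_le hb l (-h) (l * s - κ) (l ^ 2 * s / 2 - γ / 2)
      (by rw [hγ] at *; nlinarith),
    eventually_mul_exp_le hb (c := l ^ 2 * s / 2 - γ / 2) (c' := l ^ 2 * s / 2 - d)
      (by linarith) (K := 4) (by norm_num),
    eventually_mul_exp_le hb (c := l ^ 2 * s - c') (c' := l ^ 2 * s / 2 - d)
      (by linarith) (K := 2) (by norm_num),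
    hb.eventually_ge_atTop 0] with n h0 h1 h2 h3 h4 hbn
  set f : ℝ → ℝ≥0∞ := fun x => ENNReal.ofReal (Real.exp (b n * l * x)) with hf
  set E := ENNReal.ofReal (Real.exp (b n * (l ^ 2 * s / 2 - d))) with hE
  have hcover : (Set.univ : Set ℝ) ⊆
      B ∪ ({x | h * (l * s + κ) ≤ h * x} ∪ {x | -h * (l * s - κ) ≤ -h * x}) := by
    intro x _
    by_cases hx : x ∈ B
    · exact Or.inl hx
    · rw [hB, Metric.mem_ball, Real.dist_eq, not_lt, le_abs] at hx
      refine Or.inr (hx.imp (fun hx => ?_) fun hx => ?_)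
      · exact mul_le_mul_of_nonneg_left (by linarith) hh0.le
      · simp only [Set.mem_ofPred_eq]
        nlinarith
  have hsum : E ≤ ∫⁻ x in B, f x ∂(p n) + (E / 4 + E / 4) := by
    have h5 : ENNReal.ofReal (Real.exp (b n * (l ^ 2 * s / 2 - γ / 2))) ≤ E / 4 := by
      rw [ENNReal.le_div_iff_mul_le (by simp) (by simp), mul_comm]
      simpa using h3
    calc E ≤ ∫⁻ x in Set.univ, f x ∂(p n) := by rw [setLIntegral_univ]; exact h0.1
      _ ≤ _ := lintegral_mono_set hcover
      _ ≤ _ := lintegral_union_le _ _ _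
      _ ≤ _ := add_le_add le_rfl ((lintegral_union_le _ _ _).trans
        (add_le_add (h1.trans h5) (h2.trans h5)))
  have hEt : E ≠ ∞ := ENNReal.ofReal_ne_top
  have hhalf : E / 2 ≤ ∫⁻ x in B, f x ∂(p n) := by
    have h6 : E / 4 + E / 4 = E / 2 := by
      rw [← two_mul, ← mul_div_assoc, show (4 : ℝ≥0∞) = 2 * 2 by norm_num,
        ENNReal.mul_div_mul_left _ _ (by simp) (by simp)]
    rw [h6] at hsum
    nth_rewrite 1 [← ENNReal.add_halves E] at hsum
    exact (ENNReal.add_le_add_iff_right (ENNReal.div_lt_top hEt (by simp)).ne).1 hsum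
  -- On `B` the tilt exponent is at most `l² s + |l| κ`, and `κ` was chosen so that `|l| κ ≤ c -
  -- c'`.
  have hup : ∫⁻ x in B, f x ∂(p n) ≤
      ENNReal.ofReal (Real.exp (b n * (l ^ 2 * s + (c - c')))) * p n B := by
    rw [← setLIntegral_const]
    refine setLIntegral_mono' Metric.isOpen_ball.measurableSet fun x hx => ?_
    refine ENNReal.ofReal_le_ofReal (Real.exp_le_exp.2 ?_)
    rw [mul_assoc]
    refine mul_le_mul_of_nonneg_left ?_ hbn
    have h7 : |x - l * s| ≤ κ := by
      rw [hB, Metric.mem_ball, Real.dist_eq] at hx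
      exact hx.le
    have h8 : l * (x - l * s) ≤ |l| * κ := (le_abs_self _).trans (by
      rw [abs_mul]; exact mul_le_mul_of_nonneg_left h7 (abs_nonneg _))
    nlinarith
  have hlow : ENNReal.ofReal (Real.exp (b n * (l ^ 2 * s - c'))) ≤ E / 2 := by
    rw [ENNReal.le_div_iff_mul_le (by simp) (by simp), mul_comm]
    simpa using h4
  have hfin := (hlow.trans hhalf).trans hup
  refine le_trans ?_ (measure_mono hBA)
  have h9 : ENNReal.ofReal (Real.exp (-(b n * (l ^ 2 * s + (c - c'))))) *
      ENNReal.ofReal (Real.exp (b n * (l ^ 2 * s + (c - c')))) = 1 := by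
    rw [← ENNReal.ofReal_mul (Real.exp_nonneg _), ← Real.exp_add]
    simp
  calc ENNReal.ofReal (Real.exp (-(b n * c)))
      ≤ ENNReal.ofReal (Real.exp (-(b n * (l ^ 2 * s + (c - c'))))) *
        ENNReal.ofReal (Real.exp (b n * (l ^ 2 * s - c'))) := by
        rw [← ENNReal.ofReal_mul (Real.exp_nonneg _), ← Real.exp_add]
        exact ENNReal.ofReal_le_ofReal (Real.exp_le_exp.2 (le_of_eq (by ring)))
    _ ≤ _ := mul_le_mul_right hfin _
    _ = p n B := by rw [← mul_assoc, h9, one_mul]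

end GartnerEllis

/-! ### From exponential bounds to the extended-real large deviation bounds. -/

theorem coe_inv_mul_log_le {b c : ℝ} (hb : 0 < b) {q : ℝ≥0∞}
    (h : q ≤ ENNReal.ofReal (Real.exp (-(b * c)))) :
    ((b⁻¹ : ℝ) : EReal) * ENNReal.log q ≤ ((-c : ℝ) : EReal) := by
  have h1 := ENNReal.log_monotone h
  rw [ENNReal.log_ofReal_of_pos (Real.exp_pos _), Real.log_exp] at h1
  refine (mul_le_mul_of_nonneg_left h1 (EReal.coe_nonneg.2 (inv_pos.2 hb).le)).trans_eq ?_
  rw [← EReal.coe_mul]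
  congr 1
  field_simp

theorem le_coe_inv_mul_log {b c : ℝ} (hb : 0 < b) {q : ℝ≥0∞}
    (h : ENNReal.ofReal (Real.exp (-(b * c))) ≤ q) :
    ((-c : ℝ) : EReal) ≤ ((b⁻¹ : ℝ) : EReal) * ENNReal.log q := by
  have h1 := ENNReal.log_monotone h
  rw [ENNReal.log_ofReal_of_pos (Real.exp_pos _), Real.log_exp] at h1
  refine le_trans (le_of_eq ?_)
    (mul_le_mul_of_nonneg_left h1 (EReal.coe_nonneg.2 (inv_pos.2 hb).le))
  rw [← EReal.coe_mul]
  congr 1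
  field_simp

theorem rate_ofReal {s : ℝ} (hs : 0 < s) (x : ℝ) :
    rate (ENNReal.ofReal s) x = ENNReal.ofReal (x ^ 2 / (2 * s)) := by
  rw [rate, ENNReal.ofReal_div_of_pos (by positivity), ENNReal.ofReal_mul two_pos.le]
  simp

theorem rate_abs (s : ℝ≥0∞) (x : ℝ) : rate s |x| = rate s x := by
  rw [rate, rate, sq_abs]

/-- The rate is the Legendre transform of `k ↦ k² s / 2`, with maximiser `k = r / s`; for `s = 0`
the function `k r` is unbounded and a large `k` suffices. -/
theorem exists_lt_mul_sub_of_lt_rate {s r c : ℝ} (hs : 0 ≤ s) (hr : 0 ≤ r) (hc : 0 ≤ c)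
    (h : ENNReal.ofReal c < rate (ENNReal.ofReal s) r) :
    ∃ k > 0, c < k * r - k ^ 2 * s / 2 := by
  rcases hs.eq_or_lt with rfl | hs
  · have hr0 : r ≠ 0 := by
      rintro rfl
      simp [rate] at h
    have hr' : 0 < r := lt_of_le_of_ne hr hr0.symm
    refine ⟨(c + 1) / r, by positivity, ?_⟩
    rw [div_mul_cancel₀ _ hr0]
    linarith
  · rw [rate_ofReal hs] at h
    have h' : c < r ^ 2 / (2 * s) := by
      by_contra! hle
      exact absurd h (not_lt.2 (ENNReal.ofReal_le_ofReal hle))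
    have hr' : 0 < r := by
      refine lt_of_le_of_ne hr ?_
      rintro rfl
      simp at h'
      linarith
    refine ⟨r / s, by positivity, h'.trans_eq ?_⟩
    field_simp
    ring

/-- A point of finite rate is the centre `l * s` of some tilt; for `s = 0` only the origin
qualifies. -/
theorem exists_eq_mul_of_rate_ne_top {s x : ℝ} (hs : 0 ≤ s)
    (h : rate (ENNReal.ofReal s) x ≠ ∞) :
    ∃ l, x = l * s ∧ rate (ENNReal.ofReal s) x = ENNReal.ofReal (l ^ 2 * s / 2) := by
  rcases hs.eq_or_lt with rfl | hs
  · have hx : x = 0 := by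
      by_contra hx
      refine h ?_
      rw [rate]
      simp only [ENNReal.ofReal_zero, mul_zero]
      exact ENNReal.div_zero (ENNReal.ofReal_pos.2 (by positivity)).ne'
    exact ⟨0, by simp [hx], by simp [rate, hx]⟩
  · refine ⟨x / s, by field_simp, ?_⟩
    rw [rate_ofReal hs]
    congr 1
    field_simp

section Deviation

variable {p : ℕ → Measure ℝ} {b : ℕ → ℝ} {s : ℝ}

theorem HasGaussianLaplace.limsup_le (H : HasGaussianLaplace p b s) (hs : 0 ≤ s)
    (hb : Tendsto b atTop atTop) (hp : ∀ n, IsProbabilityMeasure (p n)) (A : Set ℝ) :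
    limsup (fun n => (((b n)⁻¹ : ℝ) : EReal) * ENNReal.log (p n A)) atTop ≤
      -((⨅ x ∈ closure A, rate (ENNReal.ofReal s) x : ℝ≥0∞) : EReal) := by
  rw [EReal.le_neg]
  refine le_of_forall_lt fun z hz => ?_
  by_cases hz0 : z < 0
  · refine hz0.trans_le ?_
    rw [EReal.le_neg]
    simp only [neg_zero]
    refine limsup_le_of_le (by isBoundedDefault) ?_
    filter_upwards [hb.eventually_gt_atTop 0] with n hn
    have := coe_inv_mul_log_le (c := 0) hn (q := p n A) (by simpa using prob_le_one)
    simpa using this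
  obtain ⟨c, hzc, hcJ⟩ := EReal.lt_iff_exists_real_btwn.1 hz
  have hc0 : 0 ≤ c := EReal.coe_nonneg.1 ((not_lt.1 hz0).trans hzc.le)
  refine hzc.trans_le ?_
  rw [EReal.le_neg, ← EReal.coe_neg]
  refine limsup_le_of_le (by isBoundedDefault) ?_
  have hcJ' : ENNReal.ofReal c < ⨅ x ∈ closure A, rate (ENNReal.ofReal s) x := by
    rw [← EReal.coe_ennreal_lt_coe_ennreal_iff, EReal.coe_ennreal_ofReal, max_eq_left hc0]
    exact hcJ
  rcases A.eq_empty_or_nonempty with rfl | hne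
  · filter_upwards [hb.eventually_gt_atTop 0] with n hn
    exact coe_inv_mul_log_le hn (by simp)
  -- The rate increases with `|x|`, so a point of the closure nearest to `0` reduces the upper bound
  -- to the two tails `|x| ≥ |y|`.
  · obtain ⟨y, hy, hyr⟩ := isClosed_closure.exists_infDist_eq_dist hne.closure (0 : ℝ)
    have hr : ∀ x ∈ A, |y| ≤ |x| := by
      intro x hx
      have := Metric.infDist_le_dist_of_mem (x := (0 : ℝ)) (subset_closure hx)
      rw [hyr] at this
      simpa [Real.dist_eq] using this
    have hlt : ENNReal.ofReal c < rate (ENNReal.ofReal s) |y| := by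
      rw [rate_abs]
      exact hcJ'.trans_le (iInf₂_le y hy)
    obtain ⟨k, hk, hkc⟩ := exists_lt_mul_sub_of_lt_rate hs (abs_nonneg y) hc0 hlt
    filter_upwards [H.eventually_measure_le hb hk hkc hr, hb.eventually_gt_atTop 0] with n hn hbn
    exact coe_inv_mul_log_le hbn hn

theorem HasGaussianLaplace.le_liminf (H : HasGaussianLaplace p b s) (hs : 0 ≤ s)
    (hb : Tendsto b atTop atTop) (A : Set ℝ) :
    -((⨅ x ∈ interior A, rate (ENNReal.ofReal s) x : ℝ≥0∞) : EReal) ≤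
      liminf (fun n => (((b n)⁻¹ : ℝ) : EReal) * ENNReal.log (p n A)) atTop := by
  rw [EReal.neg_le]
  refine le_of_forall_gt fun z hz => ?_
  obtain ⟨c, hJc, hcz⟩ := EReal.lt_iff_exists_real_btwn.1 hz
  have hc0 : 0 ≤ c := EReal.coe_nonneg.1 ((EReal.coe_ennreal_nonneg _).trans hJc.le)
  refine lt_of_le_of_lt ?_ hcz
  rw [EReal.neg_le, ← EReal.coe_neg]
  have hJc' : ⨅ x ∈ interior A, rate (ENNReal.ofReal s) x < ENNReal.ofReal c := by
    rw [← EReal.coe_ennreal_lt_coe_ennreal_iff, EReal.coe_ennreal_ofReal, max_eq_left hc0]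
    exact hJc
  obtain ⟨x, hx⟩ := iInf_lt_iff.1 hJc'
  obtain ⟨hxA, hxc⟩ := iInf_lt_iff.1 hx
  obtain ⟨l, rfl, hl⟩ := exists_eq_mul_of_rate_ne_top hs hxc.ne_top
  rw [hl] at hxc
  obtain ⟨ε, hε, hball⟩ := Metric.isOpen_iff.1 isOpen_interior _ hxA
  refine le_liminf_of_le (by isBoundedDefault) ?_
  filter_upwards [H.eventually_le_measure hs hb hε (ENNReal.ofReal_lt_ofReal_iff'.1 hxc).1
    (hball.trans interior_subset), hb.eventually_gt_atTop 0] with n hn hbn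
  exact le_coe_inv_mul_log hbn hn

end Deviation

/-! ### Moments and second-order Laplace expansion of a single step. -/

section MarkSum

theorem markSum_mono {f g : ℝ → ℝ} (h : ∀ x, f x ≤ g x) (x : Mark) : markSum f x ≤ markSum g x :=
  Finset.sum_le_sum fun _ _ => h _

theorem abs_markSum_le {f g : ℝ → ℝ} (h : ∀ x, |f x| ≤ g x) (x : Mark) :
    |markSum f x| ≤ markSum g x :=
  (Finset.abs_sum_le_sum_abs _ _).trans (Finset.sum_le_sum fun _ _ => h _)

theorem ofReal_markSum {f : ℝ → ℝ} (h : ∀ x, 0 ≤ f x) (x : Mark) :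
    ENNReal.ofReal (markSum f x) = markSum (fun y => ENNReal.ofReal (f y)) x :=
  ENNReal.ofReal_sum_of_nonneg fun _ _ => h _

variable {μ : Measure Mark} {δ : ℝ}

theorem integrable_markSum_of_nonneg {f : ℝ → ℝ} (hf : Measurable f) (h : ∀ x, 0 ≤ f x)
    (hfin : ∫⁻ x, markSum (fun y => ENNReal.ofReal (f y)) x ∂μ ≠ ∞) :
    Integrable (markSum f) μ := by
  refine ⟨(measurable_markSum hf).aestronglyMeasurable, ?_⟩
  rw [hasFiniteIntegral_iff_ofReal
    (ae_of_all _ fun x => show 0 ≤ markSum f x from Finset.sum_nonneg fun _ _ => h _)]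
  simp only [ofReal_markSum h]
  exact hfin.lt_top

theorem ofReal_integral_markSum {f : ℝ → ℝ} (h : ∀ x, 0 ≤ f x)
    (hint : Integrable (markSum f) μ) :
    ENNReal.ofReal (∫ x, markSum f x ∂μ) = ∫⁻ x, markSum (fun y => ENNReal.ofReal (f y)) x ∂μ := by
  rw [ofReal_integral_eq_lintegral_ofReal hint
    (ae_of_all _ fun x => Finset.sum_nonneg fun _ _ => h _)]
  simp only [ofReal_markSum h]

theorem Integrable.markSum_of_abs_le {f g : ℝ → ℝ} (hf : Measurable f) (c : ℝ)
    (h : ∀ x, |f x| ≤ c * g x) (hg : Integrable (markSum g) μ) : Integrable (markSum f) μ := by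
  refine (hg.const_mul c).mono' (measurable_markSum hf).aestronglyMeasurable
    (ae_of_all _ fun x => ?_)
  refine (abs_markSum_le h x).trans_eq ?_
  simp [markSum, Finset.mul_sum]

end MarkSum

theorem sq_le_exp_abs {δ : ℝ} (hδ : 0 < δ) (x : ℝ) : x ^ 2 ≤ 2 / δ ^ 2 * Real.exp (δ * |x|) := by
  have h := Real.pow_div_factorial_le_exp (x := δ * |x|) (by positivity) 2
  rw [div_mul_eq_mul_div, le_div_iff₀ (by positivity)]
  rw [div_le_iff₀ (by positivity), mul_pow, sq_abs] at h
  simp [Nat.factorial] at h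
  linarith

theorem abs_le_exp_abs {δ : ℝ} (hδ : 0 < δ) (x : ℝ) : |x| ≤ 1 / δ * Real.exp (δ * |x|) := by
  have h := Real.add_one_le_exp (δ * |x|)
  rw [div_mul_eq_mul_div, le_div_iff₀ hδ]
  linarith

/-- The Taylor remainder is at most `|t x|³ exp |t x|`. Half of the exponent `δ |x|` dominates
`|x|³`, with `48 = 3! · 2³`; the other half dominates `exp |t x|`. -/
theorem abs_exp_sub_quadratic_le {δ t : ℝ} (hδ : 0 < δ) (ht : |t| ≤ δ / 2) (x : ℝ) :
    |Real.exp (t * x) - (1 + t * x + t ^ 2 / 2 * x ^ 2)| ≤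
      |t| ^ 3 * (48 / δ ^ 3) * Real.exp (δ * |x|) := by
  have h1 := Complex.norm_exp_sub_sum_le_norm_mul_exp ((t * x : ℝ) : ℂ) 3
  have h2 : |Real.exp (t * x) - (1 + t * x + t ^ 2 / 2 * x ^ 2)| ≤
      |t * x| ^ 3 * Real.exp |t * x| := by
    rw [Complex.norm_real, Real.norm_eq_abs] at h1
    refine le_trans (le_of_eq ?_) h1
    rw [← Real.norm_eq_abs, ← Complex.norm_real]
    congr 1
    simp [Finset.sum_range_succ, Nat.factorial]
    ring
  refine h2.trans ?_
  have h3 := Real.pow_div_factorial_le_exp (x := δ / 2 * |x|) (by positivity) 3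
  have h4 : |x| ^ 3 ≤ 48 / δ ^ 3 * Real.exp (δ / 2 * |x|) := by
    rw [div_mul_eq_mul_div, le_div_iff₀ (by positivity)]
    rw [div_le_iff₀ (by positivity), mul_pow, div_pow] at h3
    simp [Nat.factorial] at h3
    linarith
  have h5 : Real.exp |t * x| ≤ Real.exp (δ / 2 * |x|) := by
    rw [abs_mul]
    exact Real.exp_le_exp.2 (mul_le_mul_of_nonneg_right ht (abs_nonneg _))
  have h6 : Real.exp (δ * |x|) = Real.exp (δ / 2 * |x|) * Real.exp (δ / 2 * |x|) := by
    rw [← Real.exp_add]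
    congr 1
    ring
  rw [abs_mul, mul_pow, ← abs_mul, h6]
  calc |t| ^ 3 * |x| ^ 3 * Real.exp |t * x|
      ≤ |t| ^ 3 * (48 / δ ^ 3 * Real.exp (δ / 2 * |x|)) * Real.exp (δ / 2 * |x|) := by gcongr
    _ = _ := by ring

/-- Uses `log (1 + y) ≥ y / (1 + y) ≥ y - 2 y²`. It is the lower companion of `1 + y ≤ exp y` when a
Taylor expansion is turned into an exponential. -/
theorem exp_sub_sq_le_one_add {y : ℝ} (hy : -(1 / 2) ≤ y) : Real.exp (y - 2 * y ^ 2) ≤ 1 + y := by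
  have h0 : 0 < 1 + y := by linarith
  have h1 : y - 2 * y ^ 2 ≤ y / (1 + y) := by
    rw [le_div_iff₀ h0]
    nlinarith [mul_nonneg (sq_nonneg y) (by linarith : 0 ≤ 1 + 2 * y)]
  refine (Real.exp_le_exp.2 h1).trans ?_
  have h2 := Real.add_one_le_exp (-(y / (1 + y)))
  have h3 : -(y / (1 + y)) + 1 = (1 + y)⁻¹ := by field_simp; ring
  rw [h3, Real.exp_neg] at h2
  exact (inv_le_inv₀ h0 (Real.exp_pos _)).1 h2

section StepLaw

variable {Θ : Type*} [MeasurableSpace Θ] (η : Kernel Θ Mark)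

/-- The normalised second moment of the displacements of a mark of law `η θ`. -/
noncomputable def stepVariance (θ : Θ) : ℝ≥0∞ :=
  (markLaplace η 0 θ)⁻¹ * ∫⁻ x, markSum (fun y => ENNReal.ofReal (y ^ 2)) x ∂(η θ)

theorem measurable_stepVariance : Measurable (stepVariance η) := by
  have h1 : Measurable fun x => markSum (fun y : ℝ => ENNReal.ofReal (Real.exp (0 * y))) x :=
    measurable_markSum (by fun_prop)
  have h2 : Measurable fun x => markSum (fun y : ℝ => ENNReal.ofReal (y ^ 2)) x :=
    measurable_markSum (by fun_prop)
  exact h1.lintegral_kernel.inv.mul h2.lintegral_kernel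

/-- The mean displacement measure of `η θ` is finite, nonzero and centred, and its normalised
exponential moment of order `δ` is at most `C`. -/
structure IsCenteredStep (δ C : ℝ) (θ : Θ) : Prop where
  pos : 0 < markLaplace η 0 θ
  lt_top : markLaplace η 0 θ < ∞
  exp_le : ∫⁻ x, markSum (fun y => ENNReal.ofReal (Real.exp (δ * |y|))) x ∂(η θ) ≤
    ENNReal.ofReal C * markLaplace η 0 θ
  mean : ∫ x, markSum (fun y => y) x ∂(η θ) = 0

variable {η} {δ C : ℝ} {θ : Θ}

namespace IsCenteredStep

theorem integrable_exp_abs (h : IsCenteredStep η δ C θ) :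
    Integrable (markSum fun y => Real.exp (δ * |y|)) (η θ) :=
  integrable_markSum_of_nonneg (by fun_prop) (fun _ => Real.exp_nonneg _)
    (h.exp_le.trans_lt (ENNReal.mul_lt_top ENNReal.ofReal_lt_top h.lt_top)).ne

theorem integrable_one (hδ : 0 < δ) (h : IsCenteredStep η δ C θ) :
    Integrable (markSum fun _ => (1 : ℝ)) (η θ) :=
  Integrable.markSum_of_abs_le measurable_const 1
    (fun x => by simpa using Real.one_le_exp (by positivity)) h.integrable_exp_abs

theorem integrable_id (hδ : 0 < δ) (h : IsCenteredStep η δ C θ) :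
    Integrable (markSum fun y => (y : ℝ)) (η θ) :=
  Integrable.markSum_of_abs_le measurable_id _ (abs_le_exp_abs hδ) h.integrable_exp_abs

theorem integrable_sq (hδ : 0 < δ) (h : IsCenteredStep η δ C θ) :
    Integrable (markSum fun y => (y ^ 2 : ℝ)) (η θ) :=
  Integrable.markSum_of_abs_le (by fun_prop) _
    (fun x => by rw [abs_of_nonneg (sq_nonneg x)]; exact sq_le_exp_abs hδ x) h.integrable_exp_abs

theorem integrable_exp (hδ : 0 < δ) (h : IsCenteredStep η δ C θ) {t : ℝ} (ht : |t| ≤ δ / 2) :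
    Integrable (markSum fun y => Real.exp (t * y)) (η θ) := by
  refine Integrable.markSum_of_abs_le (by fun_prop) 1 (fun x => ?_) h.integrable_exp_abs
  rw [one_mul, abs_of_nonneg (Real.exp_nonneg _)]
  refine Real.exp_le_exp.2 ((le_abs_self _).trans ?_)
  rw [abs_mul]
  exact mul_le_mul_of_nonneg_right (by linarith) (abs_nonneg _)

theorem markLaplace_eq (hδ : 0 < δ) (h : IsCenteredStep η δ C θ) {t : ℝ} (ht : |t| ≤ δ / 2) :
    markLaplace η t θ = ENNReal.ofReal (∫ x, markSum (fun y => Real.exp (t * y)) x ∂(η θ)) :=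
  (ofReal_integral_markSum (fun _ => Real.exp_nonneg _) (h.integrable_exp hδ ht)).symm

theorem markLaplace_zero_eq (hδ : 0 < δ) (h : IsCenteredStep η δ C θ) :
    markLaplace η 0 θ = ENNReal.ofReal (∫ x, markSum (fun _ => (1 : ℝ)) x ∂(η θ)) := by
  rw [h.markLaplace_eq hδ (by simpa using (half_pos hδ).le)]
  simp

theorem integral_one_pos (hδ : 0 < δ) (h : IsCenteredStep η δ C θ) :
    0 < ∫ x, markSum (fun _ => (1 : ℝ)) x ∂(η θ) := by
  have := h.pos
  rwa [h.markLaplace_zero_eq hδ, ENNReal.ofReal_pos] at this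

theorem integral_exp_abs_le (hδ : 0 < δ) (hC : 0 ≤ C) (h : IsCenteredStep η δ C θ) :
    ∫ x, markSum (fun y => Real.exp (δ * |y|)) x ∂(η θ) ≤
      C * ∫ x, markSum (fun _ => (1 : ℝ)) x ∂(η θ) := by
  have h1 := h.exp_le
  rwa [← ofReal_integral_markSum (fun _ => Real.exp_nonneg _) h.integrable_exp_abs,
    h.markLaplace_zero_eq hδ, ← ENNReal.ofReal_mul hC,
    ENNReal.ofReal_le_ofReal_iff (mul_nonneg hC (h.integral_one_pos hδ).le)] at h1

theorem stepVariance_eq (hδ : 0 < δ) (h : IsCenteredStep η δ C θ) :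
    stepVariance η θ = ENNReal.ofReal ((∫ x, markSum (fun y => y ^ 2) x ∂(η θ)) /
      ∫ x, markSum (fun _ => (1 : ℝ)) x ∂(η θ)) := by
  rw [stepVariance, h.markLaplace_zero_eq hδ,
    ← ofReal_integral_markSum (fun _ => sq_nonneg _) (h.integrable_sq hδ),
    ENNReal.ofReal_div_of_pos (h.integral_one_pos hδ), ENNReal.div_eq_inv_mul]

theorem toReal_stepVariance (hδ : 0 < δ) (h : IsCenteredStep η δ C θ) :
    (stepVariance η θ).toReal = (∫ x, markSum (fun y => y ^ 2) x ∂(η θ)) /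
      ∫ x, markSum (fun _ => (1 : ℝ)) x ∂(η θ) := by
  rw [h.stepVariance_eq hδ, ENNReal.toReal_ofReal]
  exact div_nonneg (integral_nonneg fun x => Finset.sum_nonneg fun _ _ => sq_nonneg _)
    (h.integral_one_pos hδ).le

theorem stepVariance_le (hδ : 0 < δ) (hC : 0 ≤ C) (h : IsCenteredStep η δ C θ) :
    stepVariance η θ ≤ ENNReal.ofReal (2 / δ ^ 2 * C) := by
  rw [h.stepVariance_eq hδ]
  refine ENNReal.ofReal_le_ofReal ?_
  rw [div_le_iff₀ (h.integral_one_pos hδ), mul_assoc]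
  refine le_trans ?_ (mul_le_mul_of_nonneg_left (h.integral_exp_abs_le hδ hC) (by positivity))
  rw [← integral_const_mul]
  refine integral_mono (h.integrable_sq hδ) (h.integrable_exp_abs.const_mul _) fun x => ?_
  refine (markSum_mono (sq_le_exp_abs hδ) x).trans_eq ?_
  simp [markSum, Finset.mul_sum]

/-- Second order expansion of the Laplace transform of a centred step. -/
theorem abs_integral_exp_sub_le (hδ : 0 < δ) (hC : 0 ≤ C) (h : IsCenteredStep η δ C θ) {t : ℝ}
    (ht : |t| ≤ δ / 2) :
    |(∫ x, markSum (fun y => Real.exp (t * y)) x ∂(η θ)) /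
        (∫ x, markSum (fun _ => (1 : ℝ)) x ∂(η θ)) -
      (1 + t ^ 2 / 2 * (stepVariance η θ).toReal)| ≤ 48 / δ ^ 3 * C * |t| ^ 3 := by
  have hpos := h.integral_one_pos hδ
  rw [h.toReal_stepVariance hδ]
  set π := ∫ x, markSum (fun _ => (1 : ℝ)) x ∂(η θ) with hπ
  set V := ∫ x, markSum (fun y => y ^ 2) x ∂(η θ) with hV
  have h1 : ∫ x, markSum (fun y => Real.exp (t * y)) x ∂(η θ) - (π + t ^ 2 / 2 * V) =
      ∫ x, markSum (fun y => Real.exp (t * y) - (1 + t * y + t ^ 2 / 2 * y ^ 2)) x ∂(η θ) := by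
    have h2 : ∀ x : Mark,
        markSum (fun y => Real.exp (t * y) - (1 + t * y + t ^ 2 / 2 * y ^ 2)) x =
          markSum (fun y => Real.exp (t * y)) x - (markSum (fun _ => (1 : ℝ)) x +
            t * markSum (fun y => y) x + t ^ 2 / 2 * markSum (fun y => y ^ 2) x) := by
      intro x
      simp only [markSum, Finset.sum_sub_distrib, Finset.sum_add_distrib, Finset.mul_sum]
    simp only [h2]
    have i1 := h.integrable_one hδ
    have i2 := (h.integrable_id hδ).const_mul t
    have i3 := (h.integrable_sq hδ).const_mul (t ^ 2 / 2)
    have i12 : Integrable (fun x => markSum (fun _ => (1 : ℝ)) x + t * markSum (fun y => y) x)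
      (η θ) := i1.add i2
    have i123 : Integrable (fun x => markSum (fun _ => (1 : ℝ)) x + t * markSum (fun y => y) x +
      t ^ 2 / 2 * markSum (fun y => y ^ 2) x) (η θ) := i12.add i3
    rw [integral_sub (h.integrable_exp hδ ht) i123, integral_add i12 i3,
      integral_add i1 i2, integral_const_mul, integral_const_mul, h.mean]
    ring
  have h3 : |∫ x, markSum (fun y => Real.exp (t * y)) x ∂(η θ) - (π + t ^ 2 / 2 * V)| ≤
      48 / δ ^ 3 * C * |t| ^ 3 * π := by
    rw [h1]
    calc _ ≤ ∫ x, |t| ^ 3 * (48 / δ ^ 3) * markSum (fun y => Real.exp (δ * |y|)) x ∂(η θ) := by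
          rw [← Real.norm_eq_abs]
          refine norm_integral_le_of_norm_le (h.integrable_exp_abs.const_mul _)
            (ae_of_all _ fun x => ?_)
          refine (abs_markSum_le (abs_exp_sub_quadratic_le hδ ht) x).trans_eq ?_
          simp [markSum, Finset.mul_sum]
      _ = |t| ^ 3 * (48 / δ ^ 3) * ∫ x, markSum (fun y => Real.exp (δ * |y|)) x ∂(η θ) :=
          integral_const_mul _ _
      _ ≤ |t| ^ 3 * (48 / δ ^ 3) * (C * π) :=
          mul_le_mul_of_nonneg_left (h.integral_exp_abs_le hδ hC) (by positivity)
      _ = _ := by ring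
  have h4 : ∀ E : ℝ, E / π - (1 + t ^ 2 / 2 * (V / π)) = (E - (π + t ^ 2 / 2 * V)) / π := by
    intro E
    field_simp
  rw [h4, abs_div, abs_of_pos hpos, div_le_iff₀ hpos]
  exact h3

end IsCenteredStep

/-- Uniform Gaussian bounds for the Laplace transform of a centred step near the origin. -/
theorem exists_markLaplace_bounds (η : Kernel Θ Mark) {δ C : ℝ} (hδ : 0 < δ) (hC : 0 ≤ C) :
    ∃ K t₀ : ℝ, 0 < t₀ ∧ ∀ θ, IsCenteredStep η δ C θ → ∀ t, |t| ≤ t₀ →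
      markLaplace η 0 θ * ENNReal.ofReal
          (Real.exp (t ^ 2 / 2 * (stepVariance η θ).toReal - K * |t| ^ 3)) ≤ markLaplace η t θ ∧
      markLaplace η t θ ≤ markLaplace η 0 θ * ENNReal.ofReal
          (Real.exp (t ^ 2 / 2 * (stepVariance η θ).toReal + K * |t| ^ 3)) := by
  set K₀ := 48 / δ ^ 3 * C with hK₀
  set V := 2 / δ ^ 2 * C with hV
  have hK₀0 : 0 ≤ K₀ := by positivity
  have hV0 : 0 ≤ V := by positivity
  set D := V / 2 + K₀ with hD
  have hD0 : 0 ≤ D := by positivity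
  -- `K₀` is the Taylor error and `2 D²` pays for `2 y²`, where `|y| ≤ D |t|²`. The three bounds on
  -- `|t|` serve the expansion, the comparison of powers of `|t|`, and `y ≥ -1/2`.
  refine ⟨K₀ + 2 * D ^ 2, min (δ / 2) (min 1 (1 / (2 * (D + 1)))), by positivity,
    fun θ h t ht => ?_⟩
  have ht1 : |t| ≤ δ / 2 := ht.trans (min_le_left _ _)
  have ht2 : |t| ≤ 1 := ht.trans ((min_le_right _ _).trans (min_le_left _ _))
  have ht3 : |t| ≤ 1 / (2 * (D + 1)) := ht.trans ((min_le_right _ _).trans (min_le_right _ _))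
  have hpos := h.integral_one_pos hδ
  have hmain := h.abs_integral_exp_sub_le hδ hC ht1
  rw [h.markLaplace_eq hδ ht1, h.markLaplace_zero_eq hδ, ← ENNReal.ofReal_mul hpos.le,
    ← ENNReal.ofReal_mul hpos.le]
  rw [← hK₀] at hmain
  set π := ∫ x, markSum (fun _ => (1 : ℝ)) x ∂(η θ)
  set E := ∫ x, markSum (fun y => Real.exp (t * y)) x ∂(η θ)
  set v := (stepVariance η θ).toReal with hv
  have hv0 : 0 ≤ v := ENNReal.toReal_nonneg
  have hvV : v ≤ V := by
    have := ENNReal.toReal_mono ENNReal.ofReal_ne_top (h.stepVariance_le hδ hC)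
    rwa [ENNReal.toReal_ofReal hV0] at this
  have hEπ : E = π * (E / π) := by field_simp
  obtain ⟨hl, hu⟩ := abs_le.1 hmain
  rw [hEπ]
  set T := |t| with hT
  have hT0 : 0 ≤ T := abs_nonneg t
  have htT : t ^ 2 = T ^ 2 := (sq_abs t).symm
  have hT3 : 0 ≤ T ^ 3 := by positivity
  constructor
  · refine ENNReal.ofReal_le_ofReal (mul_le_mul_of_nonneg_left ?_ hpos.le)
    set y := t ^ 2 / 2 * v - K₀ * T ^ 3 with hy
    have hT32 : T ^ 3 ≤ T ^ 2 := pow_le_pow_of_le_one hT0 ht2 (by norm_num)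
    have hyD : |y| ≤ D * T ^ 2 := by
      have e1 : t ^ 2 / 2 * v ≤ V / 2 * T ^ 2 := by rw [htT]; nlinarith [sq_nonneg T]
      have e2 : 0 ≤ t ^ 2 / 2 * v := by positivity
      have e3 : K₀ * T ^ 3 ≤ K₀ * T ^ 2 := mul_le_mul_of_nonneg_left hT32 hK₀0
      have e4 : 0 ≤ K₀ * T ^ 3 := by positivity
      have e5 : 0 ≤ V / 2 * T ^ 2 := by positivity
      rw [abs_le, hy, hD, add_mul]
      constructor <;> linarith
    have hDT : D * T ≤ 1 / 2 := by
      rw [le_div_iff₀ (by positivity)] at ht3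
      nlinarith
    have hy2 : -(1 / 2) ≤ y := by
      have := (abs_le.1 hyD).1
      nlinarith [mul_le_mul hDT ht2 hT0 (by norm_num)]
    have hysq : y ^ 2 ≤ D ^ 2 * T ^ 3 := by
      have : y ^ 2 ≤ (D * T ^ 2) ^ 2 := by
        rw [← sq_abs y]
        exact pow_le_pow_left₀ (abs_nonneg _) hyD 2
      have hT43 : T ^ 4 ≤ T ^ 3 := pow_le_pow_of_le_one hT0 ht2 (by norm_num)
      calc y ^ 2 ≤ D ^ 2 * T ^ 4 := by rw [mul_pow] at this; linarith [this]
        _ ≤ _ := mul_le_mul_of_nonneg_left hT43 (sq_nonneg _)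
    calc _ ≤ Real.exp (y - 2 * y ^ 2) := Real.exp_le_exp.2 (by rw [hy]; rw [hy] at hysq; linarith)
      _ ≤ 1 + y := exp_sub_sq_le_one_add hy2
      _ ≤ _ := by rw [hy]; linarith
  · refine ENNReal.ofReal_le_ofReal (mul_le_mul_of_nonneg_left ?_ hpos.le)
    calc E / π ≤ (t ^ 2 / 2 * v + K₀ * T ^ 3) + 1 := by linarith
      _ ≤ Real.exp (t ^ 2 / 2 * v + K₀ * T ^ 3) := Real.add_one_le_exp _
      _ ≤ _ := Real.exp_le_exp.2 (by nlinarith [mul_nonneg (sq_nonneg D) hT3])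

end StepLaw

/-! ### Products along the environment and almost sure properties of its steps. -/

theorem iterate_shift {Θ : Type*} (ξ : ℕ → Θ) (k : ℕ) : shift^[k] ξ 0 = ξ k := by
  have h : ∀ j, shift^[k] ξ j = ξ (j + k) := by
    induction k generalizing ξ with
    | zero => simp
    | succ k ih =>
      intro j
      rw [Function.iterate_succ_apply, ih, shift, add_assoc]
  simpa using h 0

section Environment

variable {Θ : Type*} [MeasurableSpace Θ] (η : Kernel Θ Mark) [IsMarkovKernel η]

theorem meanZ_univ (ξ : ℕ → Θ) (n : ℕ) :
    meanZ η ξ n Set.univ = ∏ k ∈ Finset.range n, markLaplace η 0 (ξ k) := by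
  rw [← lintegral_exp_meanZ η ξ 0 n]
  simp

variable {η} {δ C : ℝ} {ξ : ℕ → Θ}

theorem meanZ_univ_ne_zero (hξ : ∀ k, IsCenteredStep η δ C (ξ k)) (n : ℕ) :
    meanZ η ξ n Set.univ ≠ 0 := by
  rw [meanZ_univ]
  exact Finset.prod_ne_zero_iff.2 fun k _ => (hξ k).pos.ne'

theorem meanZ_univ_ne_top (hξ : ∀ k, IsCenteredStep η δ C (ξ k)) (n : ℕ) :
    meanZ η ξ n Set.univ ≠ ∞ := by
  rw [meanZ_univ]
  exact ENNReal.prod_ne_top fun k _ => (hξ k).lt_top.ne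

theorem isProbabilityMeasure_normalizedMean (hξ : ∀ k, IsCenteredStep η δ C (ξ k)) (n : ℕ)
    (c : ℝ) : IsProbabilityMeasure (normalizedMean η ξ n c) := by
  refine ⟨?_⟩
  rw [normalizedMean, Measure.smul_apply, Measure.map_apply (by fun_prop) MeasurableSet.univ,
    Set.preimage_univ, smul_eq_mul]
  exact ENNReal.inv_mul_cancel (meanZ_univ_ne_zero hξ n) (meanZ_univ_ne_top hξ n)

theorem lintegral_exp_normalizedMean (ξ : ℕ → Θ) (n : ℕ) (c t : ℝ) :
    ∫⁻ x, ENNReal.ofReal (Real.exp (t * x)) ∂(normalizedMean η ξ n c) =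
      (meanZ η ξ n Set.univ)⁻¹ * ∏ k ∈ Finset.range n, markLaplace η (t / c) (ξ k) := by
  rw [normalizedMean, lintegral_smul_measure, lintegral_map (by fun_prop) (by fun_prop),
    ← lintegral_exp_meanZ, smul_eq_mul]
  congr 2
  funext x
  congr 2
  ring

theorem prod_mul_ofReal_exp (w : ℕ → ℝ) (n : ℕ) :
    ∏ k ∈ Finset.range n, (markLaplace η 0 (ξ k) * ENNReal.ofReal (Real.exp (w k))) =
      meanZ η ξ n Set.univ * ENNReal.ofReal (Real.exp (∑ k ∈ Finset.range n, w k)) := by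
  rw [Finset.prod_mul_distrib, ← meanZ_univ, Real.exp_sum,
    ENNReal.ofReal_prod_of_nonneg fun _ _ => Real.exp_nonneg _]

/-- The normalised mean measures have Gaussian Laplace asymptotics in the moderate deviation
range. -/
theorem hasGaussianLaplace_normalizedMean (hδ : 0 < δ) (hC : 0 ≤ C)
    (hξ : ∀ k, IsCenteredStep η δ C (ξ k)) {s : ℝ}
    (hs : Tendsto (fun n : ℕ => (∑ k ∈ Finset.range n, (stepVariance η (ξ k)).toReal) / n) atTop
      (𝓝 s)) {a : ℕ → ℝ} (ha : ∀ n, 0 < a n)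
    (ha_n : Tendsto (fun n : ℕ => a n / (n : ℝ)) atTop (𝓝 0)) :
    HasGaussianLaplace (fun n => normalizedMean η ξ n (a n)) (fun n => a n ^ 2 / n) s := by
  intro l ε hε
  obtain ⟨K, t₀, ht₀, hK⟩ := exists_markLaplace_bounds η hδ hC
  set v : ℕ → ℝ := fun k => (stepVariance η (ξ k)).toReal with hv
  have hlim : ∀ K : ℝ, Tendsto (fun n : ℕ => l ^ 2 * ((∑ k ∈ Finset.range n, v k) / n) / 2 +
      K * |l| ^ 3 * (a n / n)) atTop (𝓝 (l ^ 2 * s / 2)) := by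
    intro K
    simpa using ((hs.const_mul (l ^ 2)).div_const 2).add (ha_n.const_mul (K * |l| ^ 3))
  have htlim : Tendsto (fun n : ℕ => |l| * (a n / n)) atTop (𝓝 0) := by
    simpa using ha_n.const_mul |l|
  filter_upwards [(hlim K).eventually_le_const (show l ^ 2 * s / 2 < l ^ 2 * s / 2 + ε by linarith),
    (hlim (-K)).eventually_const_le (show l ^ 2 * s / 2 - ε < l ^ 2 * s / 2 by linarith),
    htlim.eventually_le_const ht₀, eventually_gt_atTop 0] with n hu hl ht hn
  have hn' : (0 : ℝ) < n := by exact_mod_cast hn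
  have han := ha n
  have hb : 0 ≤ a n ^ 2 / n := by positivity
  -- Slope `l` at speed `a n ^ 2 / n`, with space scaled by `a n`, probes each step at an argument
  -- tending to `0`.
  have htn : a n ^ 2 / n * l / a n = l * (a n / n) := by field_simp
  have htabs : |l * (a n / n)| = |l| * (a n / n) := by
    rw [abs_mul, abs_of_pos (div_pos han hn')]
  set t := l * (a n / n) with htdef
  -- The `n` cubic errors total the speed times `K |l|³ a_n / n`, hence are negligible because `a_n
  -- / n → 0`.
  have hsum : ∀ K : ℝ, ∑ k ∈ Finset.range n, (t ^ 2 / 2 * v k + K * |t| ^ 3) =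
      a n ^ 2 / n * (l ^ 2 * ((∑ k ∈ Finset.range n, v k) / n) / 2 +
        K * |l| ^ 3 * (a n / n)) := by
    intro K
    rw [Finset.sum_add_distrib, ← Finset.mul_sum, Finset.sum_const, Finset.card_range, htabs,
      nsmul_eq_mul, htdef]
    field_simp
  have h0 := meanZ_univ_ne_zero hξ n
  have h1 := meanZ_univ_ne_top hξ n
  rw [lintegral_exp_normalizedMean, htn]
  constructor
  · have hle : meanZ η ξ n Set.univ * ENNReal.ofReal (Real.exp
        (∑ k ∈ Finset.range n, (t ^ 2 / 2 * v k + -K * |t| ^ 3))) ≤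
        ∏ k ∈ Finset.range n, markLaplace η t (ξ k) := by
      rw [← prod_mul_ofReal_exp]
      refine Finset.prod_le_prod' fun k _ => ?_
      rw [neg_mul, ← sub_eq_add_neg]
      exact (hK _ (hξ k) t (htabs.trans_le ht)).1
    refine le_trans ?_ (mul_le_mul_right hle _)
    rw [← mul_assoc, ENNReal.inv_mul_cancel h0 h1, one_mul, hsum]
    exact ENNReal.ofReal_le_ofReal (Real.exp_le_exp.2 (mul_le_mul_of_nonneg_left hl hb))
  · have hle : ∏ k ∈ Finset.range n, markLaplace η t (ξ k) ≤
        meanZ η ξ n Set.univ * ENNReal.ofReal (Real.exp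
        (∑ k ∈ Finset.range n, (t ^ 2 / 2 * v k + K * |t| ^ 3))) := by
      rw [← prod_mul_ofReal_exp]
      exact Finset.prod_le_prod' fun k _ => (hK _ (hξ k) t (htabs.trans_le ht)).2
    refine (mul_le_mul_right hle _).trans ?_
    rw [← mul_assoc, ENNReal.inv_mul_cancel h0 h1, one_mul, hsum]
    exact ENNReal.ofReal_le_ofReal (Real.exp_le_exp.2 (mul_le_mul_of_nonneg_left hu hb))

variable (η)

theorem sigmaSq_eq (τ : Measure (ℕ → Θ)) :
    sigmaSq η τ = ∫⁻ ξ, stepVariance η (ξ 0) ∂τ := by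
  simp only [sigmaSq, m_eq, stepVariance]
  refine lintegral_congr fun ξ => ?_
  rw [quenchedSum_eq η ξ 0 (by fun_prop)]

theorem integral_quenchedLaw_root (ξ : ℕ → Θ) :
    ∫ ω, ∑ i ∈ Finset.range (ω []).1, (ω []).2 i ∂(quenchedLaw η ξ) =
      ∫ x, markSum (fun y => y) x ∂(η (ξ 0)) := by
  have h := measurePreserving_eval_infinitePi (fun u : Label => η (ξ u.length)) []
  have h2 : Measure.map (Function.eval ([] : Label)) (quenchedLaw η ξ) = η (ξ 0) := h.map_eq
  rw [← h2]
  exact (integral_map h.measurable.aemeasurable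
    (measurable_markSum measurable_id).aestronglyMeasurable).symm

theorem ae_isCenteredStep {τ : Measure (ℕ → Θ)}
    (hpi : ∀ᵐ ξ ∂τ, 0 < m η ξ 0 0 ∧ m η ξ 0 0 < ∞)
    (hexp : essSup (fun ξ => (m η ξ 0 0)⁻¹ *
      quenchedSum η ξ 0 (fun x => ENNReal.ofReal (Real.exp (δ * |x|)))) τ < ∞)
    (hmean : ∀ᵐ ξ ∂τ,
      ∫ ω, ∑ i ∈ Finset.range (ω []).1, (ω []).2 i ∂(quenchedLaw η ξ) = 0) :
    ∃ C, 0 ≤ C ∧ ∀ᵐ ξ ∂τ, IsCenteredStep η δ C (ξ 0) := by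
  refine ⟨(essSup (fun ξ => (m η ξ 0 0)⁻¹ * quenchedSum η ξ 0
    (fun x => ENNReal.ofReal (Real.exp (δ * |x|)))) τ).toReal, ENNReal.toReal_nonneg, ?_⟩
  filter_upwards [hpi, hmean, ENNReal.ae_le_essSup (μ := τ) (fun ξ => (m η ξ 0 0)⁻¹ *
      quenchedSum η ξ 0 (fun x => ENNReal.ofReal (Real.exp (δ * |x|))))] with ξ h1 h2 h3
  rw [m_eq] at h1 h3
  rw [quenchedSum_eq η ξ 0 (by fun_prop)] at h3
  refine ⟨h1.1, h1.2, ?_, ?_⟩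
  · rw [ENNReal.ofReal_toReal hexp.ne]
    rwa [← ENNReal.div_eq_inv_mul, ENNReal.div_le_iff h1.1.ne' h1.2.ne] at h3
  · rw [← integral_quenchedLaw_root]
    exact h2

theorem ae_forall_of_ae_zero {τ : Measure (ℕ → Θ)} (hτ : MeasurePreserving shift τ τ)
    {P : Θ → Prop} (h : ∀ᵐ ξ ∂τ, P (ξ 0)) : ∀ᵐ ξ ∂τ, ∀ k, P (ξ k) := by
  refine ae_all_iff.2 fun k => ?_
  filter_upwards [(hτ.iterate k).quasiMeasurePreserving.ae h] with ξ hξ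
  rwa [iterate_shift] at hξ

end Environment

end BRWRE

/-! ### Assembly of the moderate deviation principle. -/

theorem mainTheorem7 {Θ : Type*} [MeasurableSpace Θ]
    (τ : Measure (ℕ → Θ)) [IsProbabilityMeasure τ] (hτ : Ergodic BRWRE.shift τ)
    (η : Kernel Θ BRWRE.Mark) [IsMarkovKernel η]
    (hpi : ∀ᵐ ξ ∂τ, 0 < BRWRE.m η ξ 0 0 ∧ BRWRE.m η ξ 0 0 < ∞)
    (δ : ℝ) (hδ : 0 < δ)
    (hexp : essSup (fun ξ => (BRWRE.m η ξ 0 0)⁻¹ *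
      BRWRE.quenchedSum η ξ 0 (fun x => ENNReal.ofReal (Real.exp (δ * |x|)))) τ < ∞)
    (hmean : ∀ᵐ ξ ∂τ,
      ∫ ω, ∑ i ∈ Finset.range (ω []).1, (ω []).2 i ∂(BRWRE.quenchedLaw η ξ) = 0)
    (a : ℕ → ℝ) (ha : ∀ n, 0 < a n)
    (ha_n : Tendsto (fun n : ℕ => a n / (n : ℝ)) atTop (𝓝 0))
    (ha_sqrt : Tendsto (fun n : ℕ => a n / Real.sqrt (n : ℝ)) atTop atTop) :
    BRWRE.sigmaSq η τ < ∞ ∧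
    ∀ᵐ ξ ∂τ,
      (∀ n, IsProbabilityMeasure (BRWRE.normalizedMean η ξ n (a n))) ∧
      ∀ A : Set ℝ, MeasurableSet A →
        -((⨅ x ∈ interior A, BRWRE.rate (BRWRE.sigmaSq η τ) x : ℝ≥0∞) : EReal) ≤
          liminf (fun n : ℕ => (((n : ℝ) / a n ^ 2 : ℝ) : EReal) *
            ENNReal.log (BRWRE.normalizedMean η ξ n (a n) A)) atTop ∧
        liminf (fun n : ℕ => (((n : ℝ) / a n ^ 2 : ℝ) : EReal) *
            ENNReal.log (BRWRE.normalizedMean η ξ n (a n) A)) atTop ≤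
          limsup (fun n : ℕ => (((n : ℝ) / a n ^ 2 : ℝ) : EReal) *
            ENNReal.log (BRWRE.normalizedMean η ξ n (a n) A)) atTop ∧
        limsup (fun n : ℕ => (((n : ℝ) / a n ^ 2 : ℝ) : EReal) *
            ENNReal.log (BRWRE.normalizedMean η ξ n (a n) A)) atTop ≤
          -((⨅ x ∈ closure A, BRWRE.rate (BRWRE.sigmaSq η τ) x : ℝ≥0∞) : EReal) := by
  obtain ⟨C, hC, hstep⟩ := BRWRE.ae_isCenteredStep η hpi hexp hmean
  set V := 2 / δ ^ 2 * C with hV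
  have hbound : ∀ᵐ ξ ∂τ, BRWRE.stepVariance η (ξ 0) ≤ ENNReal.ofReal V := by
    filter_upwards [hstep] with ξ hξ using hξ.stepVariance_le hδ hC
  have hσ : BRWRE.sigmaSq η τ < ∞ := by
    rw [BRWRE.sigmaSq_eq]
    refine (lintegral_mono_ae hbound).trans_lt ?_
    simp
  refine ⟨hσ, ?_⟩
  have hmeas : Measurable fun ξ : ℕ → Θ => BRWRE.stepVariance η (ξ 0) :=
    (BRWRE.measurable_stepVariance η).comp (measurable_pi_apply 0)
  have hint : Integrable (fun ξ : ℕ → Θ => (BRWRE.stepVariance η (ξ 0)).toReal) τ :=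
    integrable_toReal_of_lintegral_ne_top hmeas.aemeasurable
      (by rw [← BRWRE.sigmaSq_eq]; exact hσ.ne)
  have hmeanσ : ∫ ξ, (BRWRE.stepVariance η (ξ 0)).toReal ∂τ = (BRWRE.sigmaSq η τ).toReal := by
    rw [BRWRE.sigmaSq_eq, integral_toReal hmeas.aemeasurable]
    filter_upwards [hbound] with ξ hξ using hξ.trans_lt ENNReal.ofReal_lt_top
  -- The speed is the square of `a n / √n`.
  have hb : Tendsto (fun n : ℕ => a n ^ 2 / (n : ℝ)) atTop atTop := by
    refine (ha_sqrt.atTop_mul_atTop₀ ha_sqrt).congr fun n => ?_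
    rw [div_mul_div_comm, Real.mul_self_sqrt (Nat.cast_nonneg n), sq]
  have hinv : ∀ n : ℕ, (n : ℝ) / a n ^ 2 = (a n ^ 2 / (n : ℝ))⁻¹ := fun n => (inv_div _ _).symm
  filter_upwards [BRWRE.ae_forall_of_ae_zero hτ.toMeasurePreserving hstep,
    BRWRE.ae_tendsto_birkhoffSum_div hτ hmeas.ennreal_toReal hint] with ξ hξ hbirk
  have hprob := fun n => BRWRE.isProbabilityMeasure_normalizedMean hξ n (a n)
  -- The null set of environments is fixed before `A`, so one set of full measure serves all Borel
  -- sets.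
  refine ⟨hprob, fun A _ => ?_⟩
  rw [hmeanσ] at hbirk
  simp only [birkhoffSum, BRWRE.iterate_shift] at hbirk
  have H := BRWRE.hasGaussianLaplace_normalizedMean hδ hC hξ hbirk ha ha_n
  have h1 := H.le_liminf ENNReal.toReal_nonneg hb A
  have h2 := H.limsup_le ENNReal.toReal_nonneg hb hprob A
  rw [ENNReal.ofReal_toReal hσ.ne] at h1 h2
  simp only [hinv]
  exact ⟨h1, liminf_le_limsup, h2⟩
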